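/- \textbf{Theorem (lower bound for testing a sparse change in mean at a known location).} For $n,d\ge 1$ let $X_i=\theta+\Delta\,\mathbf 1\{i>\tau\}+\xi_i$, $i=1,\dots,n$, where $\xi_1,\dots,\xi_n$ are i.i.d. $\mathcal N(0,I_d)$, the baseline mean $\theta\in\mathbb R^d$ is an unknown nuisance parameter, $\Delta\in\mathbb R^d$ is the jump and $\tau\in\{1,\dots,n-1\}$ is the given change location. Let $\mathbf E_{\theta,\Delta}$ be the expectation under the law of $(X_1,\dots,X_n)$ ($\Delta=0$ means no change). For $1\le p\le d$ and $r>0$ let $$\Theta_p[r]=\Bigl\{(\varepsilon_1v_1,\dots,\varepsilon_dv_d):\ v\in\mathbb R^d,\ \varepsilon_j\in\{0,1\},\ \sum_{j=1}^d\varepsilon_j=p\Bigr\}\cap\{v\in\mathbb R^d:\ \|v\|\ge r\},$$ where $\|\cdot\|$ is the Euclidean norm. A test is a measurable function $\psi=\psi(X_1,\dots,X_n)$ with values in $[0,1]$, and its total error for testing $\Delta=0$ against $\Delta\in\Theta_p[r]$, in the worst case over the unknown $\theta$, is $$\gamma(\psi,\Theta_p[r],\tau)=\sup_{\theta\in\mathbb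 R^d}\Bigl(\mathbf E_{\theta,0}\psi+\sup_{\Delta\in\Theta_p[r]}\mathbf E_{\theta,\Delta}(1-\psi)\Bigr).$$ Put $h(\tau)=\frac{\tau}{n}\bigl(1-\frac{\tau}{n}\bigr)$. Let $\beta\in[0,1)$ and let $n=n(d)$, $p=p(d)\in\{1,\dots,d\}$, $\tau=\tau(d)\in\{1,\dots,n-1\}$ and $r=r(d)>0$ depend on $d$ in such a way that, as $d\to\infty$, $n\to\infty$ (Assumption (A1)), $p\asymp d^{1-\beta}$ and $$\lim_{d\to\infty}\frac{r^2nh(\tau)}{\sqrt d}=0,$$ and, in the case $\beta\in(1/2,1)$, also $$\limsup_{d\to\infty}\frac{r^2nh(\tau)}{p\log(d/p)}<2-\frac1\beta .$$ Then $$\inf_{\psi}\gamma(\psi,\Theta_p[r],\tau)\to1\qquad\text{as } d\to\infty,$$ where the infimum is over all tests. -/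

import Mathlib

open Filter Topology MeasureTheory ProbabilityTheory

namespace ChangePoint

/-- The data space: `n` observations, each of them a vector of `ℝ^d` with its Euclidean norm.
The observation `X_i`, `i = 1, …, n`, is the coordinate with index `i - 1`. -/
abbrev Sample (n d : ℕ) : Type := Fin n → EuclideanSpace ℝ (Fin d)

/-- The law of the noise `(ξ_1, …, ξ_n)`: i.i.d. standard Gaussian vectors of `ℝ^d`. -/
noncomputable def noise (n d : ℕ) : Measure (Sample n d) :=
  Measure.pi fun _ => stdGaussian (EuclideanSpace ℝ (Fin d))

/-- The observations `X_i = θ + Δ 1{i > τ} + ξ_i`, `i = 1, …, n`. -/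
noncomputable def observe {n d : ℕ} (θ Δ : EuclideanSpace ℝ (Fin d)) (τ : ℕ) (ξ : Sample n d) :
    Sample n d :=
  fun i => θ + (if τ < (i : ℕ) + 1 then Δ else 0) + ξ i

/-- The law of `(X_1, …, X_n)` with mean `θ` before the change, jump `Δ` and location `τ`.
For `Δ = 0` this is the law under the null hypothesis, for any `τ`. -/
noncomputable def law (n d : ℕ) (θ Δ : EuclideanSpace ℝ (Fin d)) (τ : ℕ) :
    Measure (Sample n d) :=
  (noise n d).map (observe θ Δ τ)

/-- The vectors `(ε_1 v_1, …, ε_d v_d)` with `ε_j ∈ {0, 1}` and `∑ ε_j = p`. -/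
def sparseVectors (d p : ℕ) : Set (EuclideanSpace ℝ (Fin d)) :=
  {v | ∃ (ε : Fin d → ℕ) (w : EuclideanSpace ℝ (Fin d)),
    (∀ j, ε j = 0 ∨ ε j = 1) ∧ ∑ j, ε j = p ∧ ∀ j, v j = (ε j : ℝ) * w j}

/-- The set `Θ_p[r]` of alternatives: `p`-sparse vectors of Euclidean norm at least `r`. -/
def alternatives (d p : ℕ) (r : ℝ) : Set (EuclideanSpace ℝ (Fin d)) :=
  {v | v ∈ sparseVectors d p ∧ r ≤ ‖v‖}

/-- A (randomized) test: a measurable function of the observations with values in `[0, 1]`. -/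
def Test (n d : ℕ) : Type :=
  {ψ : Sample n d → ℝ // Measurable ψ ∧ ∀ x, 0 ≤ ψ x ∧ ψ x ≤ 1}

/-- Type I error `E_0 ψ`, when the mean without a change is `θ`. -/
noncomputable def typeIError {n d : ℕ} (ψ : Test n d) (θ : EuclideanSpace ℝ (Fin d)) (τ : ℕ) : ℝ :=
  ∫ x, ψ.1 x ∂(law n d θ 0 τ)

/-- Type II error `sup_{Δ ∈ Θ_p[r]} E_Δ (1 - ψ)`, when the mean before the change is `θ`. -/
noncomputable def typeIIError {n d : ℕ} (ψ : Test n d) (θ : EuclideanSpace ℝ (Fin d))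
    (p : ℕ) (r : ℝ) (τ : ℕ) : ℝ :=
  ⨆ Δ : alternatives d p r, ∫ x, (1 - ψ.1 x) ∂(law n d θ Δ τ)

/-- Total error, when the mean before the change is `θ`. -/
noncomputable def totalErrorAt {n d : ℕ} (ψ : Test n d) (θ : EuclideanSpace ℝ (Fin d))
    (p : ℕ) (r : ℝ) (τ : ℕ) : ℝ :=
  typeIError ψ θ τ + typeIIError ψ θ p r τ

/-- Total error of a test; the baseline mean `θ` is an unknown nuisance parameter, so that the
error is the worst one over `θ`. -/
noncomputable def totalError {n d : ℕ} (ψ : Test n d) (p : ℕ) (r : ℝ) (τ : ℕ) : ℝ :=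
  ⨆ θ : EuclideanSpace ℝ (Fin d), totalErrorAt ψ θ p r τ

/-- `h(τ) = (τ/n) (1 - τ/n)`. -/
noncomputable def h (n τ : ℕ) : ℝ := (τ : ℝ) / n * (1 - (τ : ℝ) / n)

end ChangePoint

/-!
The trivial test that never rejects has error at most `1`, so only the lower bound is at issue. It
comes from the second moment method, with a prior on the jump and an averaging argument for the
baseline mean.

*Prior.* Choose `p` disjoint blocks of `m = ⌊d / p⌋` coordinates, and in each block, independently,
a uniform coordinate and a uniform sign. The jump has the entries `± r / √p` there and zeros
elsewhere, so that it is `p`-sparse of norm `r`. Since the blocks are independent, the second moment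
factorizes exactly (`sum_exp_sum_overlap`), and no hypergeometric law has to be estimated.

*Nuisance parameter.* A test does not know `θ`, and the worst case over `θ` may be replaced by
an average over a large box of a lattice. The jumps of the prior, multiplied by `1 - τ / n`,
translate this lattice by bounded amounts, and such translations do not matter in the limit of
large boxes (`le_of_forall_le_of_forall_sub_le`). Hence the null hypothesis with mean `θ` may be
compared with the alternative with baseline `θ - (1 - τ / n) Δ`. The means then differ by multiples
of `Δ` whose coefficients have the sum of squares `n h(τ)` (`sum_contrast_sq`); this is where the
effective sample size `n h(τ)` comes from.

*Second moment.* The likelihood ratio of a Gaussian shift is found coordinate by coordinate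
(`noise_map_add`), and the product of two of them is `exp` of the inner product of the shifts times
the likelihood ratio of the sum of the shifts (`likelihood_mul`). This gives the `χ²`-divergence
`(1 + (cosh l - 1) / m) ^ p - 1` with `l = r² n h(τ) / p` (`one_sub_sqrt_le_totalError`), which
tends to zero as soon as `p² / d * (cosh l - 1)` does. For `β ≤ 1 / 2` the argument `l` tends to
zero and the expression is at most `(r² n h(τ))² / d`; for `β > 1 / 2` the second condition bounds
`exp l` by `(d / p) ^ κ` with `κ < 2 - 1 / β`, and `p² / d * (d / p) ^ κ` is at most a constant
times a negative power of `d`.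
-/

namespace ChangePoint

open scoped RealInnerProductSpace

/-! ### Likelihood ratios of Gaussian shifts -/

lemma map_withDensity_comp {X Y : Type*} [MeasurableSpace X] [MeasurableSpace Y]
    (μ : Measure X) {g : X → Y} (hg : Measurable g) {f : Y → ENNReal} (hf : Measurable f) :
    (μ.withDensity (fun x => f (g x))).map g = (μ.map g).withDensity f := by
  ext s hs
  rw [Measure.map_apply hg hs, withDensity_apply _ (hg hs), withDensity_apply _ hs,
    setLIntegral_map hs hf hg]

/-- If translating each factor of a product measure has a density of the form `exp L`, then
translating the product has the product density. -/
lemma pi_map_add {ι : Type*} [Fintype ι] {X : ι → Type*} [∀ i, MeasurableSpace (X i)]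
    [∀ i, Add (X i)] [∀ i, MeasurableAdd (X i)] (μ : ∀ i, Measure (X i))
    [∀ i, IsProbabilityMeasure (μ i)] (m : ∀ i, X i) {L : ∀ i, X i → ℝ}
    (hL : ∀ i, Measurable (L i))
    (hμ : ∀ i, (μ i).map (fun x => m i + x) =
      (μ i).withDensity (fun x => ENNReal.ofReal (Real.exp (L i x)))) :
    (Measure.pi μ).map (fun x i => m i + x i) =
      (Measure.pi μ).withDensity (fun x => ENNReal.ofReal (Real.exp (∑ i, L i (x i)))) := by
  have hprob : ∀ i, IsProbabilityMeasure ((μ i).map (fun x => m i + x)) := fun i =>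
    Measure.isProbabilityMeasure_map (measurable_const_add _).aemeasurable
  rw [Measure.pi_map_pi (fun i => (measurable_const_add (m i)).aemeasurable)]
  refine Measure.pi_eq fun s hs => ?_
  rw [withDensity_apply _ (.univ_pi hs), ← lintegral_indicator (.univ_pi hs)]
  have hF : ∀ i, Measurable ((s i).indicator fun x => ENNReal.ofReal (Real.exp (L i x))) :=
    fun i => Measurable.indicator (by have := hL i; fun_prop) (hs i)
  have key := lintegral_prod_eq_prod_lintegral_of_indepFun Finset.univ
    (fun i (x : ∀ i, X i) => (s i).indicator (fun x => ENNReal.ofReal (Real.exp (L i x))) (x i))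
    (iIndepFun_pi (μ := μ) (fun i => (hF i).aemeasurable))
    (fun i => (hF i).comp (measurable_pi_apply i))
  have hleft : ((Set.univ.pi s).indicator fun x : ∀ i, X i =>
      ENNReal.ofReal (Real.exp (∑ i, L i (x i)))) =
      fun x => ∏ i, (s i).indicator (fun x => ENNReal.ofReal (Real.exp (L i x))) (x i) := by
    ext x
    by_cases hx : x ∈ Set.univ.pi s
    · rw [Set.indicator_of_mem hx, Real.exp_sum,
        ENNReal.ofReal_prod_of_nonneg (fun i _ => (Real.exp_pos _).le)]
      exact Finset.prod_congr rfl fun i _ => by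
        rw [Set.indicator_of_mem (hx i (Set.mem_univ i))]
    · rw [Set.indicator_of_notMem hx]
      simp only [Set.mem_univ_pi, not_forall] at hx
      obtain ⟨i, hi⟩ := hx
      exact (Finset.prod_eq_zero (Finset.mem_univ i) (Set.indicator_of_notMem hi _)).symm
  rw [hleft, key]
  refine Finset.prod_congr rfl fun i _ => ?_
  rw [hμ i, withDensity_apply _ (hs i), ← lintegral_indicator (hs i)]
  exact (measurePreserving_eval μ i).lintegral_comp (hF i)

lemma gaussianReal_map_add_eq_withDensity (m : ℝ) :
    (gaussianReal 0 1).map (fun x => m + x) =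
      (gaussianReal 0 1).withDensity
        (fun x => ENNReal.ofReal (Real.exp (m * x - m ^ 2 / 2))) := by
  rw [gaussianReal_map_const_add, gaussianReal_of_var_ne_zero _ one_ne_zero,
    gaussianReal_of_var_ne_zero _ one_ne_zero,
    ← withDensity_mul _ (measurable_gaussianPDF _ _) (by fun_prop)]
  congr 1
  ext x
  simp only [Pi.mul_apply, gaussianPDF]
  rw [← ENNReal.ofReal_mul (gaussianPDFReal_nonneg _ _ _)]
  congr 1
  simp only [gaussianPDFReal]
  rw [mul_assoc _ (Real.exp _), ← Real.exp_add]
  congr 2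
  push_cast
  ring

lemma stdGaussian_map_add {ι : Type*} [Fintype ι] (m : EuclideanSpace ℝ ι) :
    (stdGaussian (EuclideanSpace ℝ ι)).map (fun x => m + x) =
      (stdGaussian (EuclideanSpace ℝ ι)).withDensity
        (fun x => ENNReal.ofReal (Real.exp (⟪m, x⟫ - ‖m‖ ^ 2 / 2))) := by
  rw [← map_pi_eq_stdGaussian, ← map_withDensity_comp _ (by fun_prop) (by fun_prop),
    Measure.map_map (by fun_prop) (by fun_prop)]
  have hL : ∀ i : ι, Measurable (fun x : ℝ => m i * x - m i ^ 2 / 2) := fun i => by fun_prop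
  have h1 := pi_map_add (fun _ : ι => gaussianReal 0 1) (fun i => m i) hL
    (fun i => gaussianReal_map_add_eq_withDensity (m i))
  have h2 : ((fun x => m + x) ∘ (WithLp.toLp 2) : (ι → ℝ) → EuclideanSpace ℝ ι) =
      WithLp.toLp 2 ∘ fun x i => m i + x i := by
    ext x i
    simp
  rw [h2, ← Measure.map_map (by fun_prop) (by fun_prop), h1]
  congr 2
  ext x
  congr 2
  rw [EuclideanSpace.real_norm_sq_eq, PiLp.inner_apply, Finset.sum_sub_distrib, Finset.sum_div]
  simp [mul_comm]

/-- The likelihood ratio of the noise translated by `m` with respect to the noise. -/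
noncomputable def likelihood {n d : ℕ} (m x : Sample n d) : ℝ :=
  Real.exp (∑ i, (⟪m i, x i⟫ - ‖m i‖ ^ 2 / 2))

instance (n d : ℕ) : IsProbabilityMeasure (noise n d) := by
  unfold noise; infer_instance

lemma noise_map_add {n d : ℕ} (m : Sample n d) :
    (noise n d).map (fun x i => m i + x i) =
      (noise n d).withDensity (fun x => ENNReal.ofReal (likelihood m x)) :=
  pi_map_add _ m (L := fun i x => ⟪m i, x⟫ - ‖m i‖ ^ 2 / 2) (fun i => by fun_prop)
    (fun i => stdGaussian_map_add (m i))

lemma measurable_likelihood {n d : ℕ} (m : Sample n d) : Measurable (likelihood m) := by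
  unfold likelihood; fun_prop

lemma likelihood_pos {n d : ℕ} (m x : Sample n d) : 0 < likelihood m x := Real.exp_pos _

lemma integral_shift {n d : ℕ} (m : Sample n d) {f : Sample n d → ℝ} (hf : Measurable f) :
    ∫ x, f (fun i => m i + x i) ∂(noise n d) = ∫ x, f x * likelihood m x ∂(noise n d) := by
  have hm : AEMeasurable (fun (x : Sample n d) i => m i + x i) (noise n d) :=
    Measurable.aemeasurable (by fun_prop)
  rw [← integral_map hm hf.aestronglyMeasurable, noise_map_add,
    integral_withDensity_eq_integral_toReal_smul (measurable_likelihood m).ennreal_ofReal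
      (ae_of_all _ fun x => ENNReal.ofReal_lt_top)]
  refine integral_congr_ae (ae_of_all _ fun x => ?_)
  simp only [smul_eq_mul]
  rw [ENNReal.toReal_ofReal (likelihood_pos m x).le, mul_comm]

lemma integral_likelihood {n d : ℕ} (m : Sample n d) :
    ∫ x, likelihood m x ∂(noise n d) = 1 := by
  have := integral_shift m (f := fun _ => 1) measurable_const
  simpa using this.symm

lemma integrable_likelihood {n d : ℕ} (m : Sample n d) :
    Integrable (likelihood m) (noise n d) := by
  by_contra hm
  have := integral_likelihood m
  rw [integral_undef hm] at this
  exact zero_ne_one this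

lemma likelihood_mul {n d : ℕ} (m m' x : Sample n d) :
    likelihood m x * likelihood m' x =
      Real.exp (∑ i, ⟪m i, m' i⟫) * likelihood (m + m') x := by
  simp only [likelihood]
  rw [← Real.exp_add, ← Real.exp_add, ← Finset.sum_add_distrib, ← Finset.sum_add_distrib]
  congr 1
  refine Finset.sum_congr rfl fun i _ => ?_
  rw [Pi.add_apply, inner_add_left, norm_add_sq_real]
  ring

/-! ### The second moment method -/

/-- The Bayesian lower bound for testing `μ` against the uniform mixture of the laws with
densities `L ω`: the sum of both errors is at least one minus the square root of the
`χ²`-divergence. -/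
lemma one_sub_sqrt_le_errors {X Ω : Type*} [MeasurableSpace X] [Fintype Ω] [Nonempty Ω]
    (μ : Measure X) [IsProbabilityMeasure μ] {L : Ω → X → ℝ}
    (hL : ∀ ω, Integrable (L ω) μ)
    (hL1 : ∀ ω, ∫ x, L ω x ∂μ = 1) (hL2 : ∀ ω ω', Integrable (fun x => L ω x * L ω' x) μ)
    {φ : X → ℝ} (hφ : Measurable φ) (hφ01 : ∀ x, 0 ≤ φ x ∧ φ x ≤ 1) :
    1 - √((∑ ω, ∑ ω', ∫ x, L ω x * L ω' x ∂μ) / (Fintype.card Ω : ℝ) ^ 2 - 1) ≤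
      ∫ x, φ x ∂μ + (∑ ω, ∫ x, (1 - φ x) * L ω x ∂μ) / Fintype.card Ω := by
  have hN : (Fintype.card Ω : ℝ) ≠ 0 := by exact_mod_cast Fintype.card_ne_zero
  set N : ℝ := (Fintype.card Ω : ℝ)
  set W : X → ℝ := fun x => (∑ ω, L ω x) / N with hWdef
  have hW : Integrable W μ := (integrable_finsetSum _ fun ω _ => hL ω).div_const _
  have hW1 : ∫ x, W x ∂μ = 1 := by
    simp only [hWdef]
    rw [integral_div, integral_finsetSum _ fun ω _ => hL ω]
    simp only [hL1, Finset.sum_const, Finset.card_univ, nsmul_eq_mul, mul_one]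
    exact div_self hN
  have hWsq : ∀ x, W x ^ 2 = (∑ ω, ∑ ω', L ω x * L ω' x) / N ^ 2 := fun x => by
    simp only [hWdef]
    rw [div_pow, sq (∑ ω, L ω x), Finset.sum_mul_sum]
  have hW2 : Integrable (fun x => W x ^ 2) μ := by
    simp only [hWsq]
    exact (integrable_finsetSum _ fun ω _ => integrable_finsetSum _ fun ω' _ =>
      hL2 ω ω').div_const _
  have hW2i : ∫ x, W x ^ 2 ∂μ = (∑ ω, ∑ ω', ∫ x, L ω x * L ω' x ∂μ) / N ^ 2 := by
    simp only [hWsq]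
    rw [integral_div, integral_finsetSum _ fun ω _ => integrable_finsetSum _ fun ω' _ => hL2 ω ω']
    congr 1
    exact Finset.sum_congr rfl fun ω _ => integral_finsetSum _ fun ω' _ => hL2 ω ω'
  have hφi : ∀ {f : X → ℝ}, Integrable f μ → Integrable (fun x => (1 - φ x) * f x) μ := by
    intro f hf
    refine hf.bdd_mul (c := 1) (by fun_prop) (ae_of_all _ fun x => ?_)
    rw [Real.norm_eq_abs, abs_le]
    constructor <;> linarith [(hφ01 x).1, (hφ01 x).2]
  have hV : Integrable (fun x => |W x - 1|) μ := (hW.sub (integrable_const 1)).abs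
  have hφint : Integrable φ μ := by
    refine Integrable.of_bound hφ.aestronglyMeasurable 1 (ae_of_all _ fun x => ?_)
    rw [Real.norm_eq_abs, abs_le]
    constructor <;> linarith [(hφ01 x).1, (hφ01 x).2]
  set a := ∫ x, |W x - 1| ∂μ with ha
  -- Jensen's inequality, in the form `0 ≤ ∫ (|W - 1| - a)²`.
  have hasq : a ^ 2 ≤ ∫ x, W x ^ 2 ∂μ - 1 := by
    have h0 : 0 ≤ ∫ x, (|W x - 1| - a) ^ 2 ∂μ := integral_nonneg fun x => sq_nonneg _
    have h1 : ∀ x, (|W x - 1| - a) ^ 2 =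
        W x ^ 2 - 2 * W x - 2 * a * |W x - 1| + (1 + a ^ 2) := fun x => by
      rw [sub_sq, sq_abs]; ring
    simp only [h1] at h0
    have i1 : Integrable (fun x => W x ^ 2 - 2 * W x) μ := hW2.sub (hW.const_mul 2)
    have i2 : Integrable (fun x => W x ^ 2 - 2 * W x - 2 * a * |W x - 1|) μ :=
      i1.sub (hV.const_mul (2 * a))
    rw [integral_add i2 (integrable_const _), integral_sub i1 (hV.const_mul (2 * a)),
      integral_sub hW2 (hW.const_mul 2), integral_const_mul, integral_const_mul, hW1, ← ha] at h0
    simp only [integral_const, probReal_univ, smul_eq_mul] at h0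
    nlinarith
  have hsqrt : a ≤ √((∑ ω, ∑ ω', ∫ x, L ω x * L ω' x ∂μ) / N ^ 2 - 1) := by
    rw [← hW2i]
    exact Real.le_sqrt_of_sq_le hasq
  have hsum : (∑ ω, ∫ x, (1 - φ x) * L ω x ∂μ) / N = ∫ x, (1 - φ x) * W x ∂μ := by
    rw [← integral_finsetSum _ fun ω _ => hφi (hL ω), ← integral_div]
    refine integral_congr_ae (ae_of_all _ fun x => ?_)
    simp only [hWdef]
    rw [← Finset.mul_sum, mul_div_assoc]
  rw [hsum, ← integral_add hφint (hφi hW)]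
  have hle : ∫ x, (1 - |W x - 1|) ∂μ ≤ ∫ x, (φ x + (1 - φ x) * W x) ∂μ := by
    refine integral_mono ((integrable_const 1).sub hV) (hφint.add (hφi hW)) fun x => ?_
    have h1 := neg_abs_le (W x - 1)
    have h2 := abs_nonneg (W x - 1)
    have h3 := hφ01 x
    change 1 - |W x - 1| ≤ φ x + (1 - φ x) * W x
    nlinarith
  rw [integral_sub (integrable_const 1) hV, ← ha] at hle
  simp only [integral_const, probReal_univ, smul_eq_mul] at hle
  linarith

/-- The second moment bound for Gaussian shifts: the `χ²`-divergence of the uniform mixture of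
the shifts `m ω` is the mean of `exp ⟪m ω, m ω'⟫`, minus one. -/
lemma one_sub_sqrt_le_errors_shift {n d : ℕ} {Ω : Type*} [Fintype Ω] [Nonempty Ω]
    (m : Ω → Sample n d) {φ : Sample n d → ℝ} (hφ : Measurable φ)
    (hφ01 : ∀ x, 0 ≤ φ x ∧ φ x ≤ 1) :
    1 - √((∑ ω, ∑ ω', Real.exp (∑ i, ⟪m ω i, m ω' i⟫)) / (Fintype.card Ω : ℝ) ^ 2 - 1) ≤
      ∫ x, φ x ∂(noise n d) +
        (∑ ω, ∫ x, (1 - φ (fun i => m ω i + x i)) ∂(noise n d)) / Fintype.card Ω := by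
  have key := one_sub_sqrt_le_errors (noise n d) (L := fun ω => likelihood (m ω))
    (fun ω => integrable_likelihood _) (fun ω => integral_likelihood _)
    (fun ω ω' => by
      simp only [likelihood_mul]
      exact (integrable_likelihood _).const_mul _) hφ hφ01
  simp only [likelihood_mul, integral_const_mul, integral_likelihood, mul_one] at key
  refine key.trans_eq ?_
  congr 2
  exact Finset.sum_congr rfl fun ω _ =>
    (integral_shift (m ω) (f := fun x => 1 - φ x) (by fun_prop)).symm

/-! ### Averaging over a lattice of baseline means -/

/-- Averaging over large boxes of `ℤ^ι` removes bounded translations of the summands. -/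
lemma le_of_forall_le_of_forall_sub_le {ι Ω : Type*} [Fintype ι] [DecidableEq ι] [Fintype Ω]
    {f : (ι → ℤ) → ℝ} {g : Ω → (ι → ℤ) → ℝ} (s : Ω → ι → ℤ) (hf : ∀ z, 0 ≤ f z)
    (hg : ∀ ω z, 0 ≤ g ω z) {c γ : ℝ} (hγ : ∀ z, f z + ∑ ω, g ω z ≤ γ)
    (hc : ∀ z, c ≤ f z + ∑ ω, g ω (z - s ω)) : c ≤ γ := by
  obtain ⟨B, hB⟩ : ∃ B : ℕ, ∀ ω j, |s ω j| ≤ B := by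
    refine ⟨∑ ω, ∑ j, (s ω j).natAbs, fun ω j => ?_⟩
    rw [Int.abs_eq_natAbs]
    exact_mod_cast (Finset.single_le_sum (f := fun j => (s ω j).natAbs)
      (fun _ _ => Nat.zero_le _) (Finset.mem_univ j)).trans
      (Finset.single_le_sum (f := fun ω => ∑ j, (s ω j).natAbs)
      (fun _ _ => Nat.zero_le _) (Finset.mem_univ ω))
  set box : ℕ → Finset (ι → ℤ) := fun K => Finset.Icc (fun _ => -(K : ℤ)) (fun _ => (K : ℤ))
    with hbox
  have hmem : ∀ K z, z ∈ box K ↔ ∀ j, |z j| ≤ K := fun K z => by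
    simp only [hbox, Finset.mem_Icc, Pi.le_def, abs_le, forall_and]
  have hcard : ∀ K : ℕ, ((box K).card : ℝ) = (2 * K + 1 : ℝ) ^ Fintype.card ι := fun K => by
    simp only [hbox, Pi.card_Icc, Int.card_Icc, Finset.prod_const, Finset.card_univ]
    rw [show ((K : ℤ) + 1 - -(K : ℤ)).toNat = 2 * K + 1 by omega]
    push_cast
    rfl
  have hγ0 : 0 ≤ γ := (add_nonneg (hf 0) (Finset.sum_nonneg fun ω _ => hg ω 0)).trans (hγ 0)
  have hK : ∀ K : ℕ, c ≤
      γ * ((2 * (K + B : ℕ) + 1 : ℝ) / (2 * K + 1 : ℝ)) ^ Fintype.card ι := by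
    intro K
    have hsub : box K ⊆ box (K + B) := fun z hz => by
      rw [hmem] at hz ⊢
      intro j
      have := hz j
      push_cast
      linarith
    have hshift : ∀ ω, ∑ z ∈ box K, g ω (z - s ω) ≤ ∑ z ∈ box (K + B), g ω z := by
      intro ω
      rw [← Finset.sum_image (f := g ω) (g := fun z => z - s ω)
        (fun a _ b _ hab => sub_left_injective hab)]
      refine Finset.sum_le_sum_of_subset_of_nonneg (fun z hz => ?_) fun z _ _ => hg ω z
      obtain ⟨y, hy, rfl⟩ := Finset.mem_image.1 hz
      rw [hmem] at hy ⊢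
      intro j
      have h1 := hy j
      have h2 := hB ω j
      have h3 := abs_sub (y j) (s ω j)
      rw [Pi.sub_apply]
      push_cast
      linarith
    have h1 : ((box K).card : ℝ) * c ≤ (box (K + B)).card * γ :=
      calc ((box K).card : ℝ) * c = ∑ z ∈ box K, c := by rw [Finset.sum_const, nsmul_eq_mul]
        _ ≤ ∑ z ∈ box K, (f z + ∑ ω, g ω (z - s ω)) := Finset.sum_le_sum fun z _ => hc z
        _ = ∑ z ∈ box K, f z + ∑ ω, ∑ z ∈ box K, g ω (z - s ω) := by
          rw [Finset.sum_add_distrib, Finset.sum_comm]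
        _ ≤ ∑ z ∈ box (K + B), f z + ∑ ω, ∑ z ∈ box (K + B), g ω z :=
          add_le_add (Finset.sum_le_sum_of_subset_of_nonneg hsub fun z _ _ => hf z)
            (Finset.sum_le_sum fun ω _ => hshift ω)
        _ = ∑ z ∈ box (K + B), (f z + ∑ ω, g ω z) := by
          rw [Finset.sum_add_distrib, Finset.sum_comm]
        _ ≤ ∑ z ∈ box (K + B), γ := Finset.sum_le_sum fun z _ => hγ z
        _ = (box (K + B)).card * γ := by rw [Finset.sum_const, nsmul_eq_mul]
    rw [hcard, hcard] at h1
    rw [div_pow, mul_div_assoc', le_div_iff₀ (by positivity)]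
    linarith
  refine ge_of_tendsto' (x := atTop) ?_ hK
  have hlim : Tendsto (fun K : ℕ => (2 * (K + B : ℕ) + 1 : ℝ) / (2 * K + 1 : ℝ)) atTop (𝓝 1) := by
    have h1 : Tendsto (fun K : ℕ => 1 + 2 * (B : ℝ) / (2 * K + 1 : ℝ)) atTop (𝓝 (1 + 0)) := by
      refine tendsto_const_nhds.add (Tendsto.div_atTop tendsto_const_nhds ?_)
      exact tendsto_atTop_add_const_right _ _
        (tendsto_natCast_atTop_atTop.const_mul_atTop two_pos)
    rw [add_zero] at h1
    refine h1.congr fun K => ?_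
    have : (2 * K + 1 : ℝ) ≠ 0 := by positivity
    field_simp
    push_cast
    ring
  simpa using (hlim.pow (Fintype.card ι)).const_mul γ

/-! ### The least favourable prior -/

/-- The `d` coordinates contain `p` disjoint blocks of `m` coordinates, numbered by `e`. The map
`ω` selects one coordinate of each block together with a sign, and the pattern has these signs as
entries at the selected coordinates, and zeros elsewhere. -/
def signPattern {p m d : ℕ} (e : Fin p × Fin m ↪ Fin d) (ω : Fin p → Fin m × ℤˣ) : Fin d → ℤ :=
  fun j => ∑ b, if e (b, (ω b).1) = j then ((ω b).2 : ℤ) else 0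

/-- The jump `ρ` times the sign pattern of `ω`. -/
noncomputable def jump {p m d : ℕ} (e : Fin p × Fin m ↪ Fin d) (ρ : ℝ)
    (ω : Fin p → Fin m × ℤˣ) : EuclideanSpace ℝ (Fin d) :=
  WithLp.toLp 2 fun j => ρ * signPattern e ω j

/-- The contribution of one block to the inner product of two sign patterns. -/
def overlap {m : ℕ} (x y : Fin m × ℤˣ) : ℤ := if x.1 = y.1 then (x.2 : ℤ) * y.2 else 0

lemma sum_signPattern_mul {p m d : ℕ} (e : Fin p × Fin m ↪ Fin d) (ω ω' : Fin p → Fin m × ℤˣ) :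
    ∑ j, signPattern e ω j * signPattern e ω' j = ∑ b, overlap (ω b) (ω' b) := by
  simp only [signPattern, Finset.sum_mul_sum]
  rw [Finset.sum_comm]
  refine Finset.sum_congr rfl fun b _ => ?_
  rw [Finset.sum_comm, Finset.sum_eq_single b]
  · simp only [ite_mul, zero_mul, Finset.sum_ite_eq, Finset.mem_univ, if_true,
      e.injective.eq_iff, Prod.mk.injEq, true_and, overlap]
    rw [mul_ite, mul_zero]
    simp only [eq_comm]
  · intro b' _ hb
    refine Finset.sum_eq_zero fun j _ => ?_
    by_cases h1 : e (b, (ω b).1) = j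
    · have h2 : e (b', (ω' b').1) ≠ j := fun h2 =>
        hb (congrArg Prod.fst (e.injective (h2.trans h1.symm)))
      rw [if_neg h2, mul_zero]
    · rw [if_neg h1, zero_mul]
  · simp

lemma inner_jump {p m d : ℕ} (e : Fin p × Fin m ↪ Fin d) (ρ : ℝ) (ω ω' : Fin p → Fin m × ℤˣ) :
    ⟪jump e ρ ω, jump e ρ ω'⟫ = ρ ^ 2 * ∑ b, (overlap (ω b) (ω' b) : ℝ) := by
  have h1 := congrArg (Int.cast : ℤ → ℝ) (sum_signPattern_mul e ω ω')
  push_cast at h1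
  rw [← h1, PiLp.inner_apply, Finset.mul_sum]
  refine Finset.sum_congr rfl fun j _ => ?_
  simp only [jump, RCLike.inner_apply, conj_trivial]
  ring

lemma overlap_self {m : ℕ} (x : Fin m × ℤˣ) : overlap x x = 1 := by
  simp [overlap]

lemma norm_jump_sq {p m d : ℕ} (e : Fin p × Fin m ↪ Fin d) (ρ : ℝ) (ω : Fin p → Fin m × ℤˣ) :
    ‖jump e ρ ω‖ ^ 2 = ρ ^ 2 * p := by
  rw [← real_inner_self_eq_norm_sq, inner_jump]
  simp [overlap_self]

lemma jump_mem_sparseVectors {p m d : ℕ} (e : Fin p × Fin m ↪ Fin d) (ρ : ℝ)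
    (ω : Fin p → Fin m × ℤˣ) : jump e ρ ω ∈ sparseVectors d p := by
  classical
  set S : Finset (Fin d) := Finset.univ.image fun b => e (b, (ω b).1) with hS
  refine ⟨fun j => if j ∈ S then 1 else 0, jump e ρ ω, fun j => ?_, ?_, fun j => ?_⟩
  · by_cases hj : j ∈ S <;> simp [hj]
  · rw [Finset.sum_boole, Finset.filter_mem_eq_inter, Finset.univ_inter, hS,
      Finset.card_image_of_injective]
    · simp
    · intro b b' hb
      exact congrArg Prod.fst (e.injective hb)
  · by_cases hj : j ∈ S
    · simp [hj]
    · have h0 : signPattern e ω j = 0 := Finset.sum_eq_zero fun b _ => if_neg fun hb =>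
        hj (Finset.mem_image.2 ⟨b, Finset.mem_univ b, hb⟩)
      simp [hj, jump, h0]

/-- The mean of `exp (l * overlap)` over two independent selections in one block: they agree with
probability `1 / m`, and then the product of the signs is uniform. -/
lemma sum_exp_overlap {m : ℕ} (hm : 0 < m) (l : ℝ) :
    ∑ x : (Fin m × ℤˣ) × (Fin m × ℤˣ), Real.exp (l * overlap x.1 x.2) =
      (2 * m : ℝ) ^ 2 * (1 + (Real.cosh l - 1) / m) := by
  have hm' : (m : ℝ) ≠ 0 := by exact_mod_cast hm.ne'
  have h1 : ∀ x : Fin m × ℤˣ, ∑ y : Fin m × ℤˣ, Real.exp (l * overlap x y) =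
      2 * m + 2 * (Real.cosh l - 1) := by
    rintro ⟨i, u⟩
    have h2 : ∀ k : Fin m, ∑ v : ℤˣ, Real.exp (l * overlap (i, u) (k, v)) =
        2 + if i = k then 2 * (Real.cosh l - 1) else 0 := by
      intro k
      rw [Real.cosh_eq, show (Finset.univ : Finset ℤˣ) = {1, -1} from rfl,
        Finset.sum_pair (by decide)]
      by_cases hik : i = k
      · rcases Int.units_eq_one_or u with rfl | rfl <;> simp [overlap, hik] <;> ring
      · simp [overlap, hik]; norm_num
    rw [Fintype.sum_prod_type]
    simp only [h2, Finset.sum_add_distrib, Finset.sum_ite_eq, Finset.mem_univ, if_true,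
      Finset.sum_const, Finset.card_univ, Fintype.card_fin, nsmul_eq_mul]
    ring
  rw [Fintype.sum_prod_type]
  simp only [h1, Finset.sum_const, Finset.card_univ, Fintype.card_prod, Fintype.card_fin,
    Fintype.card_units_int, nsmul_eq_mul]
  push_cast
  field_simp

/-- The blocks of the prior are independent, so that its second moment factorizes. -/
lemma sum_exp_sum_overlap {p m : ℕ} (hm : 0 < m) (l : ℝ) :
    (∑ ω : Fin p → Fin m × ℤˣ, ∑ ω' : Fin p → Fin m × ℤˣ,
        Real.exp (l * ∑ b, (overlap (ω b) (ω' b) : ℝ))) /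
      (Fintype.card (Fin p → Fin m × ℤˣ) : ℝ) ^ 2 = (1 + (Real.cosh l - 1) / m) ^ p := by
  have hm' : (m : ℝ) ≠ 0 := by exact_mod_cast hm.ne'
  have h1 : ∑ ω : Fin p → Fin m × ℤˣ, ∑ ω' : Fin p → Fin m × ℤˣ,
        Real.exp (l * ∑ b, (overlap (ω b) (ω' b) : ℝ)) =
      ((2 * m : ℝ) ^ 2 * (1 + (Real.cosh l - 1) / m)) ^ p := by
    rw [← sum_exp_overlap hm, Fintype.sum_pow, ← Fintype.sum_prod_type',
      ← (Equiv.arrowProdEquivProdArrow (Fin p) (fun _ => Fin m × ℤˣ)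
        (fun _ => Fin m × ℤˣ)).sum_comp]
    refine Finset.sum_congr rfl fun q _ => ?_
    rw [Finset.mul_sum, Real.exp_sum]
    rfl
  rw [h1, mul_pow, Fintype.card_fun, Fintype.card_prod, Fintype.card_units_int,
    Fintype.card_fin, Fintype.card_fin, div_eq_iff (by positivity)]
  push_cast
  rw [mul_comm (m : ℝ) 2, pow_right_comm, mul_comm]

/-! ### The change in mean after removing the overall mean -/

/-- The coefficient of the jump in the mean of the observation `i`, when the baseline is lowered
by `(1 - τ / n)` times the jump, so that the coefficients sum to zero. -/
noncomputable def contrast (n τ : ℕ) (i : Fin n) : ℝ :=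
  (if τ < (i : ℕ) + 1 then 1 else 0) - (1 - (τ : ℝ) / n)

lemma sum_contrast_sq {n τ : ℕ} (hn : 0 < n) (hτ : τ ≤ n) :
    ∑ i, contrast n τ i ^ 2 = n * h n τ := by
  have hn' : (n : ℝ) ≠ 0 := by exact_mod_cast hn.ne'
  have hcount : ∑ i : Fin n, (if τ < (i : ℕ) + 1 then 1 else 0 : ℝ) = n - τ := by
    rw [Fin.sum_univ_eq_sum_range (fun i => (if τ < i + 1 then 1 else 0 : ℝ)), Finset.sum_boole,
      show (Finset.range n).filter (fun i => τ < i + 1) = Finset.Ico τ n by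
        ext i; simp only [Finset.mem_filter, Finset.mem_range, Finset.mem_Ico]; omega,
      Nat.card_Ico, Nat.cast_sub hτ]
  have hsq : ∀ i : Fin n, contrast n τ i ^ 2 =
      (1 - 2 * (1 - (τ : ℝ) / n)) * (if τ < (i : ℕ) + 1 then 1 else 0) +
        (1 - (τ : ℝ) / n) ^ 2 := fun i => by
    unfold contrast; split_ifs <;> ring
  simp only [hsq, Finset.sum_add_distrib, ← Finset.mul_sum, hcount, Finset.sum_const,
    Finset.card_univ, Fintype.card_fin, nsmul_eq_mul, h]
  field_simp
  ring

lemma observe_sub_smul {n d : ℕ} (θ Δ : EuclideanSpace ℝ (Fin d)) (τ : ℕ) (ξ : Sample n d) :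
    observe (θ - (1 - (τ : ℝ) / n) • Δ) Δ τ ξ =
      fun i => θ + (contrast n τ i • Δ + ξ i) := by
  ext1 i
  simp only [observe, contrast, sub_smul]
  split_ifs <;> simp <;> abel

/-! ### Bounds for the total error -/

lemma measurable_observe {n d : ℕ} (θ Δ : EuclideanSpace ℝ (Fin d)) (τ : ℕ) :
    Measurable (observe (n := n) θ Δ τ) := by
  unfold observe; fun_prop

instance (n d : ℕ) (θ Δ : EuclideanSpace ℝ (Fin d)) (τ : ℕ) :
    IsProbabilityMeasure (law n d θ Δ τ) :=
  Measure.isProbabilityMeasure_map (measurable_observe θ Δ τ).aemeasurable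

lemma integral_law {n d : ℕ} (θ Δ : EuclideanSpace ℝ (Fin d)) (τ : ℕ) {f : Sample n d → ℝ}
    (hf : Measurable f) :
    ∫ x, f x ∂(law n d θ Δ τ) = ∫ ξ, f (observe θ Δ τ ξ) ∂(noise n d) :=
  integral_map (measurable_observe θ Δ τ).aemeasurable hf.aestronglyMeasurable

lemma integral_mem_unitInterval {X : Type*} [MeasurableSpace X] (μ : Measure X)
    [IsProbabilityMeasure μ] {f : X → ℝ} (hf : ∀ x, 0 ≤ f x ∧ f x ≤ 1) :
    0 ≤ ∫ x, f x ∂μ ∧ ∫ x, f x ∂μ ≤ 1 := by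
  refine ⟨integral_nonneg fun x => (hf x).1, ?_⟩
  have := integral_mono_of_nonneg (μ := μ) (ae_of_all _ fun x => (hf x).1)
    (integrable_const (1 : ℝ)) (ae_of_all _ fun x => (hf x).2)
  simpa using this

lemma one_sub_test_mem {n d : ℕ} (ψ : Test n d) (x : Sample n d) :
    0 ≤ 1 - ψ.1 x ∧ 1 - ψ.1 x ≤ 1 := by
  have := ψ.2.2 x
  constructor <;> linarith [this.1, this.2]

lemma typeIIError_le_one {n d : ℕ} (ψ : Test n d) (θ : EuclideanSpace ℝ (Fin d)) (p : ℕ) (r : ℝ)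
    (τ : ℕ) : typeIIError ψ θ p r τ ≤ 1 :=
  Real.iSup_le (fun _ => (integral_mem_unitInterval _ (one_sub_test_mem ψ)).2) zero_le_one

lemma integral_le_typeIIError {n d : ℕ} (ψ : Test n d) (θ : EuclideanSpace ℝ (Fin d)) {p : ℕ}
    {r : ℝ} (τ : ℕ) {Δ : EuclideanSpace ℝ (Fin d)} (hΔ : Δ ∈ alternatives d p r) :
    ∫ x, (1 - ψ.1 x) ∂(law n d θ Δ τ) ≤ typeIIError ψ θ p r τ :=
  le_ciSup (f := fun Δ : alternatives d p r => ∫ x, (1 - ψ.1 x) ∂(law n d θ Δ τ))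
    ⟨1, by
      rintro _ ⟨Δ, rfl⟩
      exact (integral_mem_unitInterval _ (one_sub_test_mem ψ)).2⟩ ⟨Δ, hΔ⟩

lemma totalErrorAt_le_totalError {n d : ℕ} (ψ : Test n d) (θ : EuclideanSpace ℝ (Fin d)) (p : ℕ)
    (r : ℝ) (τ : ℕ) : totalErrorAt ψ θ p r τ ≤ totalError ψ p r τ :=
  le_ciSup (f := fun θ => totalErrorAt ψ θ p r τ)
    ⟨1 + 1, by
      rintro _ ⟨θ, rfl⟩
      exact add_le_add (integral_mem_unitInterval _ ψ.2.2).2 (typeIIError_le_one ψ θ p r τ)⟩ θ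

/-- The nonasymptotic lower bound for the error of a test, by the second moment of the prior on
`p` blocks of `m` coordinates. -/
lemma one_sub_sqrt_le_totalError {n d p m τ : ℕ} (e : Fin p × Fin m ↪ Fin d) (hm : 0 < m)
    (hp : 0 < p) (hτn : τ < n) (r : ℝ) (ψ : Test n d) :
    1 - √((1 + (Real.cosh (r ^ 2 * n * h n τ / p) - 1) / m) ^ p - 1) ≤ totalError ψ p r τ := by
  have hp' : (0 : ℝ) < p := by exact_mod_cast hp
  have : NeZero m := ⟨hm.ne'⟩
  set ρ : ℝ := r / √p with hρ
  have hρsq : ρ ^ 2 = r ^ 2 / p := by rw [hρ, div_pow, Real.sq_sqrt hp'.le]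
  set a : ℝ := 1 - (τ : ℝ) / n with ha
  set Ω := Fin p → Fin m × ℤˣ
  set N : ℝ := (Fintype.card Ω : ℝ) with hN
  have hN0 : 0 < N := by rw [hN]; exact_mod_cast Fintype.card_pos
  -- The lattice of baseline means, on which the jumps of the prior act by translations.
  set base : (Fin d → ℤ) → EuclideanSpace ℝ (Fin d) :=
    fun z => WithLp.toLp 2 fun j => a * ρ * z j with hbase
  have hbase_sub : ∀ z (ω : Ω),
      base (z - signPattern e ω) = base z - a • jump e ρ ω := fun z ω => by
    ext j
    simp [hbase, jump]
    ring
  have hjump : ∀ ω : Ω, jump e ρ ω ∈ alternatives d p r := fun ω => by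
    refine ⟨jump_mem_sparseVectors e ρ ω, abs_le_of_sq_le_sq' ?_ (norm_nonneg _) |>.2⟩
    rw [norm_jump_sq, hρsq, div_mul_cancel₀ _ hp'.ne']
  refine le_of_forall_le_of_forall_sub_le (f := fun z => typeIError ψ (base z) τ)
    (g := fun (ω : Ω) z => (∫ x, (1 - ψ.1 x) ∂(law n d (base z) (jump e ρ ω) τ)) / N)
    (fun ω => signPattern e ω) (fun z => (integral_mem_unitInterval _ ψ.2.2).1)
    (fun ω z => div_nonneg (integral_mem_unitInterval _ (one_sub_test_mem ψ)).1 hN0.le)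
    (fun z => ?_) (fun z => ?_)
  · refine le_trans ?_ (totalErrorAt_le_totalError ψ (base z) p r τ)
    refine add_le_add le_rfl ?_
    rw [← Finset.sum_div, div_le_iff₀ hN0]
    refine (Finset.sum_le_sum fun ω _ =>
      integral_le_typeIIError ψ (base z) τ (hjump ω)).trans_eq ?_
    rw [Finset.sum_const, Finset.card_univ, nsmul_eq_mul, mul_comm]
  · have hφ : Measurable fun x : Sample n d => ψ.1 (fun i => base z + x i) :=
      ψ.2.1.comp (by fun_prop)
    have key := one_sub_sqrt_le_errors_shift
      (fun (ω : Ω) i => contrast n τ i • jump e ρ ω) hφ (fun x => ψ.2.2 _)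
    have hinner : ∀ ω ω' : Ω, ∑ i, ⟪contrast n τ i • jump e ρ ω, contrast n τ i • jump e ρ ω'⟫ =
        (r ^ 2 * n * h n τ / p) * ∑ b, (overlap (ω b) (ω' b) : ℝ) := fun ω ω' => by
      simp only [real_inner_smul_left, real_inner_smul_right, inner_jump, hρsq, ← mul_assoc,
        ← Finset.sum_mul, ← sq]
      rw [sum_contrast_sq (by omega) hτn.le]
      ring
    simp only [hinner] at key
    rw [sum_exp_sum_overlap hm] at key
    refine key.trans_eq ?_
    congr 1
    · have hobs : ∀ ξ : Sample n d, observe (base z) 0 τ ξ = fun i => base z + ξ i := fun ξ => by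
        ext1 i
        simp [observe]
      exact ((integral_law (base z) 0 τ ψ.2.1).trans
        (integral_congr_ae (ae_of_all _ fun ξ => congrArg ψ.1 (hobs ξ)))).symm
    · rw [← Finset.sum_div]
      congr 1
      refine Finset.sum_congr rfl fun ω _ => ?_
      have hlaw := integral_law (base (z - signPattern e ω)) (jump e ρ ω) τ
        (f := fun x => 1 - ψ.1 x) (measurable_const.sub ψ.2.1)
      simp only [hbase_sub, ha, observe_sub_smul] at hlaw
      rw [hbase_sub]
      exact hlaw.symm

lemma iInf_totalError_le_one (n d p : ℕ) (r : ℝ) (τ : ℕ) :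
    ⨅ ψ : Test n d, totalError ψ p r τ ≤ 1 := by
  let ψ₀ : Test n d := ⟨fun _ => 0, measurable_const, fun _ => ⟨le_rfl, zero_le_one⟩⟩
  have hbdd : BddBelow (Set.range fun ψ : Test n d => totalError ψ p r τ) := by
    refine ⟨0, ?_⟩
    rintro _ ⟨ψ, rfl⟩
    refine Real.iSup_nonneg fun θ => add_nonneg (integral_mem_unitInterval _ ψ.2.2).1 ?_
    exact Real.iSup_nonneg fun Δ => (integral_mem_unitInterval _ (one_sub_test_mem ψ)).1
  refine (ciInf_le hbdd ψ₀).trans (ciSup_le fun θ => ?_)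
  have h0 : typeIError ψ₀ θ τ = 0 := by simp [typeIError, ψ₀]
  rw [totalErrorAt, h0, zero_add]
  exact typeIIError_le_one ψ₀ θ p r τ

/-- The lower bound for the minimax error with blocks of length `⌊d / p⌋`. -/
lemma one_sub_sqrt_exp_le_iInf_totalError {n d p τ : ℕ} (hp : 1 ≤ p) (hpd : p ≤ d) (hτn : τ < n)
    (r : ℝ) :
    1 - √(Real.exp (2 * ((p : ℝ) ^ 2 / d * (Real.cosh (r ^ 2 * n * h n τ / p) - 1))) - 1) ≤
      ⨅ ψ : Test n d, totalError ψ p r τ := by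
  have : Nonempty (Test n d) :=
    ⟨⟨fun _ => 0, measurable_const, fun _ => ⟨le_rfl, zero_le_one⟩⟩⟩
  refine le_ciInf fun ψ => ?_
  have hm : 0 < d / p := Nat.div_pos hpd hp
  let e : Fin p × Fin (d / p) ↪ Fin d :=
    finProdFinEquiv.toEmbedding.trans (Fin.castLEEmb (Nat.mul_div_le d p))
  refine le_trans ?_ (one_sub_sqrt_le_totalError e hm hp hτn r ψ)
  refine sub_le_sub_left (Real.sqrt_le_sqrt (sub_le_sub_right ?_ 1)) 1
  set c := Real.cosh (r ^ 2 * n * h n τ / p) - 1 with hc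
  have hc0 : 0 ≤ c := sub_nonneg.2 (Real.one_le_cosh _)
  have hm' : (0 : ℝ) < (d / p : ℕ) := by exact_mod_cast hm
  have hp' : (0 : ℝ) < p := by exact_mod_cast hp
  have hd' : (0 : ℝ) < d := by exact_mod_cast hp.trans hpd
  have hdm : (d : ℝ) ≤ 2 * (p * (d / p : ℕ)) := by
    have h1 := Nat.lt_mul_div_succ d (Nat.pos_of_ne_zero (Nat.one_le_iff_ne_zero.1 hp))
    have h2 : p * 1 ≤ p * (d / p) := Nat.mul_le_mul_left p hm
    have h3 : d ≤ 2 * (p * (d / p)) := by rw [Nat.mul_add] at h1; omega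
    exact_mod_cast h3
  calc (1 + c / (d / p : ℕ)) ^ p ≤ Real.exp (c / (d / p : ℕ)) ^ p := by
        refine pow_le_pow_left₀ (by positivity) ?_ p
        linarith [Real.add_one_le_exp (c / (d / p : ℕ))]
    _ = Real.exp (p * (c / (d / p : ℕ))) := (Real.exp_nat_mul _ _).symm
    _ ≤ Real.exp (2 * ((p : ℝ) ^ 2 / d * c)) := by
        refine Real.exp_le_exp.2 ?_
        rw [show 2 * ((p : ℝ) ^ 2 / d * c) = 2 * p ^ 2 * c / d by ring, ← mul_div_assoc,
          div_le_div_iff₀ hm' hd']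
        calc (p : ℝ) * c * d ≤ p * c * (2 * (p * (d / p : ℕ))) := by gcongr
          _ = 2 * p ^ 2 * c * (d / p : ℕ) := by ring

/-! ### The second moment under the asymptotic conditions -/

lemma cosh_sub_one_le_sq {x : ℝ} (hx : |x| ≤ 1) : Real.cosh x - 1 ≤ x ^ 2 := by
  have hx2 : x ^ 2 ≤ 1 := (sq_le_one_iff_abs_le_one x).2 hx
  have h1 := Real.cosh_le_exp_half_sq x
  have h2 := Real.abs_exp_sub_one_le (x := x ^ 2 / 2) (by
    rw [abs_of_nonneg (by positivity)]; linarith)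
  rw [abs_of_nonneg (a := x ^ 2 / 2) (by positivity)] at h2
  linarith [le_abs_self (Real.exp (x ^ 2 / 2) - 1)]

lemma tendsto_second_moment_dense {β : ℝ} (hβ : β ≤ 1 / 2) {p : ℕ → ℕ} {v : ℕ → ℝ}
    (hp : ∀ᶠ d in atTop, 1 ≤ p d)
    (hpβ : (fun d : ℕ => (d : ℝ) ^ (1 - β)) =O[atTop] fun d => (p d : ℝ))
    (hlin : Tendsto (fun d : ℕ => v d / √d) atTop (𝓝 0)) :
    Tendsto (fun d : ℕ => (p d : ℝ) ^ 2 / d * (Real.cosh (v d / p d) - 1)) atTop (𝓝 0) := by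
  obtain ⟨C, hC, hCp⟩ := hpβ.exists_pos
  have hsmall : ∀ᶠ d : ℕ in atTop, C * |v d / √d| < 1 := by
    have h1 : Tendsto (fun d : ℕ => C * |v d / √d|) atTop (𝓝 0) := by
      simpa using hlin.abs.const_mul C
    exact h1.eventually (gt_mem_nhds one_pos)
  refine squeeze_zero' (Eventually.of_forall fun d =>
    mul_nonneg (by positivity) (sub_nonneg.2 (Real.one_le_cosh _))) (g := fun d => (v d / √d) ^ 2)
    ?_ (by simpa using hlin.pow 2)
  filter_upwards [hsmall, hCp.bound, hp, eventually_ge_atTop 1] with d h1 h2 h3 h4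
  have hp' : (0 : ℝ) < p d := by exact_mod_cast h3
  have hd : (1 : ℝ) ≤ d := by exact_mod_cast h4
  have hd0 : (0 : ℝ) < d := by linarith
  have hsd : √(d : ℝ) ≤ C * p d := by
    rw [Real.norm_of_nonneg (by positivity), Real.norm_of_nonneg hp'.le] at h2
    refine le_trans ?_ h2
    rw [Real.sqrt_eq_rpow]
    exact Real.rpow_le_rpow_of_exponent_le hd (by linarith)
  have hx : |v d / p d| ≤ 1 := by
    refine le_trans ?_ h1.le
    rw [abs_div, abs_div, abs_of_pos hp', abs_of_pos (Real.sqrt_pos.2 hd0), mul_div_assoc',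
      div_le_div_iff₀ hp' (Real.sqrt_pos.2 hd0)]
    nlinarith [mul_le_mul_of_nonneg_left hsd (abs_nonneg (v d))]
  calc (p d : ℝ) ^ 2 / d * (Real.cosh (v d / p d) - 1)
      ≤ (p d : ℝ) ^ 2 / d * (v d / p d) ^ 2 := by
        gcongr
        exact cosh_sub_one_le_sq hx
    _ = (v d / √d) ^ 2 := by
        rw [div_pow, div_pow, Real.sq_sqrt hd0.le]
        field_simp

/-- In the sparse case `exp (v / p) ≤ (d / p) ^ κ` with `κ < 2 - 1 / β`, and this is the exponent
up to which `p ^ 2 / d * (d / p) ^ κ` vanishes for `p` of order `d ^ (1 - β)`. -/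
lemma tendsto_second_moment_sparse {β : ℝ} (hβ : 1 / 2 < β) {p : ℕ → ℕ} {v : ℕ → ℝ}
    (hp : ∀ᶠ d in atTop, 1 ≤ p d) (hv : ∀ᶠ d in atTop, 0 ≤ v d)
    (hpβ : Asymptotics.IsTheta atTop (fun d => (p d : ℝ)) (fun d : ℕ => (d : ℝ) ^ (1 - β)))
    (hscan : limsup (fun d : ℕ => ((v d / (p d * Real.log ((d : ℝ) / p d)) : ℝ) : EReal)) atTop <
      ((2 - 1 / β : ℝ) : EReal)) :
    Tendsto (fun d : ℕ => (p d : ℝ) ^ 2 / d * (Real.cosh (v d / p d) - 1)) atTop (𝓝 0) := by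
  have hβ0 : 0 < β := by linarith
  obtain ⟨κ, hκ1, hκ2⟩ := EReal.lt_iff_exists_real_btwn.1 hscan
  have hκ : κ < 2 - 1 / β := EReal.coe_lt_coe_iff.1 hκ2
  have hκβ : 1 - 2 * β + β * κ < 0 := by
    have h1 := mul_lt_mul_of_pos_left hκ hβ0
    rw [mul_sub, mul_one_div_cancel hβ0.ne'] at h1
    linarith
  have hratio := eventually_lt_of_limsup_lt hκ1
  obtain ⟨C, hC, hCp⟩ := hpβ.1.exists_pos
  obtain ⟨C', hC', hCp'⟩ := hpβ.2.exists_pos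
  have hlarge : ∀ᶠ d : ℕ in atTop, C < (d : ℝ) ^ β :=
    ((tendsto_rpow_atTop hβ0).comp tendsto_natCast_atTop_atTop).eventually_gt_atTop C
  have hlim : Tendsto (fun d : ℕ => C ^ 2 * C' ^ κ * (d : ℝ) ^ (1 - 2 * β + β * κ)) atTop
      (𝓝 0) := by
    have h1 := (tendsto_rpow_neg_atTop (neg_pos.2 hκβ)).comp tendsto_natCast_atTop_atTop
    rw [neg_neg] at h1
    simpa using h1.const_mul (C ^ 2 * C' ^ κ)
  refine squeeze_zero' (Eventually.of_forall fun d =>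
    mul_nonneg (by positivity) (sub_nonneg.2 (Real.one_le_cosh _))) ?_ hlim
  filter_upwards [hratio, hCp.bound, hCp'.bound, hlarge, hp, hv, eventually_ge_atTop 1]
    with d h1 h2 h3 h4 h5 h6 h7
  have hp' : (0 : ℝ) < p d := by exact_mod_cast h5
  have hd0 : (0 : ℝ) < d := by exact_mod_cast h7
  have hpow : (0 : ℝ) < (d : ℝ) ^ (1 - β) := by positivity
  rw [Real.norm_of_nonneg hp'.le, Real.norm_of_nonneg hpow.le] at h2 h3
  have hsplit : (d : ℝ) = (d : ℝ) ^ β * (d : ℝ) ^ (1 - β) := by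
    rw [← Real.rpow_add hd0, add_sub_cancel, Real.rpow_one]
  have hgt : 1 < (d : ℝ) / p d := by
    rw [one_lt_div hp']
    calc (p d : ℝ) ≤ C * (d : ℝ) ^ (1 - β) := h2
      _ < (d : ℝ) ^ β * (d : ℝ) ^ (1 - β) := by gcongr
      _ = d := hsplit.symm
  have hlog : 0 < Real.log ((d : ℝ) / p d) := Real.log_pos hgt
  have hle : (d : ℝ) / p d ≤ C' * (d : ℝ) ^ β := by
    rw [div_le_iff₀ hp']
    calc (d : ℝ) = (d : ℝ) ^ β * (d : ℝ) ^ (1 - β) := hsplit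
      _ ≤ (d : ℝ) ^ β * (C' * p d) := by gcongr
      _ = C' * (d : ℝ) ^ β * p d := by ring
  have h1' : v d / (p d * Real.log ((d : ℝ) / p d)) < κ := EReal.coe_lt_coe_iff.1 h1
  have hκ0 : 0 ≤ κ := le_trans (by positivity) h1'.le
  have hx0 : 0 ≤ v d / p d := by positivity
  have hx : v d / p d ≤ Real.log ((d : ℝ) / p d) * κ := by
    rw [← div_div, div_lt_iff₀ hlog] at h1'
    linarith
  have hexp : Real.cosh (v d / p d) - 1 ≤ ((d : ℝ) / p d) ^ κ := by
    rw [Real.rpow_def_of_pos (by linarith), Real.cosh_eq]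
    have e1 := Real.exp_le_exp.2 hx
    have e2 : Real.exp (-(v d / p d)) ≤ Real.exp (v d / p d) := Real.exp_le_exp.2 (by linarith)
    linarith
  calc (p d : ℝ) ^ 2 / d * (Real.cosh (v d / p d) - 1)
      ≤ (C * (d : ℝ) ^ (1 - β)) ^ 2 / d * (C' * (d : ℝ) ^ β) ^ κ := by
        gcongr
        · exact sub_nonneg.2 (Real.one_le_cosh _)
        · exact hexp.trans (Real.rpow_le_rpow (by linarith) hle hκ0)
    _ = C ^ 2 * C' ^ κ * (d : ℝ) ^ (1 - 2 * β + β * κ) := by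
        rw [Real.mul_rpow hC'.le (by positivity), ← Real.rpow_mul hd0.le, mul_pow,
          ← Real.rpow_natCast ((d : ℝ) ^ (1 - β)), ← Real.rpow_mul hd0.le,
          show 1 - 2 * β + β * κ = (1 - β) * (2 : ℕ) - 1 + β * κ by push_cast; ring,
          Real.rpow_add hd0, Real.rpow_sub_one hd0.ne']
        ring

end ChangePoint

theorem mainTheorem2 (β : ℝ) (hβ0 : 0 ≤ β) (hβ1 : β < 1)
    (n p τ : ℕ → ℕ) (r : ℕ → ℝ)
    (hp : ∀ᶠ d in atTop, 1 ≤ p d ∧ p d ≤ d)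
    (hτ : ∀ᶠ d in atTop, 1 ≤ τ d ∧ τ d < n d)
    (hr : ∀ᶠ d in atTop, 0 < r d)
    (hpβ : Asymptotics.IsTheta atTop (fun d => (p d : ℝ)) (fun d : ℕ => (d : ℝ) ^ (1 - β)))
    (hn : Tendsto n atTop atTop)
    (hlin : Tendsto (fun d : ℕ => r d ^ 2 * n d * ChangePoint.h (n d) (τ d) / Real.sqrt d)
      atTop (𝓝 0))
    (hscan : 1 / 2 < β →
      limsup (fun d : ℕ => ((r d ^ 2 * n d * ChangePoint.h (n d) (τ d) /
        (p d * Real.log ((d : ℝ) / p d)) : ℝ) : EReal)) atTop < ((2 - 1 / β : ℝ) : EReal)) :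
    Tendsto (fun d : ℕ => ⨅ ψ : ChangePoint.Test (n d) d,
      ChangePoint.totalError ψ (p d) (r d) (τ d)) atTop (𝓝 1) := by
  have hp1 : ∀ᶠ d in atTop, 1 ≤ p d := hp.mono fun d hd => hd.1
  have hv : ∀ᶠ d in atTop, 0 ≤ r d ^ 2 * n d * ChangePoint.h (n d) (τ d) := by
    filter_upwards [hτ] with d hd
    have h1 : (τ d : ℝ) / n d ≤ 1 := div_le_one_of_le₀ (by exact_mod_cast hd.2.le) (by positivity)
    have h2 : 0 ≤ 1 - (τ d : ℝ) / n d := sub_nonneg.2 h1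
    unfold ChangePoint.h
    positivity
  have hQ : Tendsto (fun d : ℕ => (p d : ℝ) ^ 2 / d *
      (Real.cosh (r d ^ 2 * n d * ChangePoint.h (n d) (τ d) / p d) - 1)) atTop (𝓝 0) := by
    rcases le_or_gt β (1 / 2) with hβ | hβ
    · exact ChangePoint.tendsto_second_moment_dense hβ hp1 hpβ.2 hlin
    · exact ChangePoint.tendsto_second_moment_sparse hβ hp1 hv hpβ (hscan hβ)
  have hlow : Tendsto (fun d : ℕ => 1 - √(Real.exp (2 * ((p d : ℝ) ^ 2 / d *
      (Real.cosh (r d ^ 2 * n d * ChangePoint.h (n d) (τ d) / p d) - 1))) - 1)) atTop (𝓝 1) := by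
    have hcont : Continuous fun x : ℝ => 1 - √(Real.exp (2 * x) - 1) := by fun_prop
    have hlim := (hcont.tendsto 0).comp hQ
    rw [mul_zero, Real.exp_zero, sub_self, Real.sqrt_zero, sub_zero] at hlim
    exact hlim
  refine tendsto_of_tendsto_of_tendsto_of_le_of_le' hlow tendsto_const_nhds ?_
    (Eventually.of_forall fun d => ChangePoint.iInf_totalError_le_one _ _ _ _ _)
  filter_upwards [hp, hτ] with d h1 h2
  exact ChangePoint.one_sub_sqrt_exp_le_iInf_totalError h1.1 h1.2 h2.2 (r d)
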